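/- Let $G$ be a finite group with center $Z(G)$ and derived subgroup $G'$. For a normal subgroup $N$ of $G$ with $1 < N < G$, the pair $(G,N)$ is called a Camina pair if every element $g \in G \setminus N$ is conjugate in $G$ to every element of the coset $gN$. Suppose that $(G,Z(G))$ is a Camina pair and that $Z(G) < G'$ (proper containment). Then $G$ is a $p$-group for some prime $p$ (necessarily unique), and for this prime $p$ either $|Z(G)|^2 \le |G:Z(G)|$ or $|Z(G)|\,p^4 \le |G:Z(G)|$. In particular, if $|G:Z(G)| \le p^8$, then $|Z(G)| \le |G:Z(G)|^{1/2}$. -/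

import Mathlib

/-- `IsCaminaPair N` says that `(G, N)` is a Camina pair: `N` is a normal subgroup of `G` with
`1 < N < G`, and every element `g` of `G` outside `N` is conjugate in `G` to every element of
the coset `gN`. -/
structure IsCaminaPair {G : Type*} [Group G] (N : Subgroup G) : Prop where
  normal : N.Normal
  bot_lt : ⊥ < N
  lt_top : N < ⊤
  isConj : ∀ g : G, g ∉ N → ∀ n ∈ N, IsConj g (g * n)

/-!
Write `Z` for the center. If a prime `q` divides `|Z|` and `g ∉ Z`, then `g` is conjugate to `g * z`
with `z ∈ Z` of order `q`, so `q` divides the order of `g`. Hence `G ⧸ Z` is a `q`-group for every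
such `q`; as it is nontrivial there is only one, say `p`, and `G` is a `p`-group.

For `x ∉ Z` let `D x` be the centralizer of `x` modulo `Z`. The Camina condition says that
`y ↦ ⁅y, x⁆` maps `D x` onto `Z`, so that `|G : C(x)| = |Z| * |G : D x|`, and `Z` is a proper
subgroup of `C(x)`, so that `p * |Z| * |G : D x|` divides `|G : Z|`. Since `Z < G'` there are `x`
and `y` with `⁅x, y⁆ ∉ Z`. As `D x ⊓ D y` centralizes `⁅x, y⁆`, we get
`|Z| ≤ |G : D x| * |G : D y|`, and multiplying the bounds for `x` and `y` gives
`p ^ 2 * |Z| ^ 3 ≤ |G : Z| ^ 2`. Moreover an irreducible character that is nontrivial on `Z`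
vanishes outside `Z`, so `|G : Z|` is the square of its degree. With an even exponent of `p` in
`|G : Z|`, the inequality leaves only the asserted alternative.
-/

open Subgroup
open scoped MonoidAlgebra commutatorElement

section Representation

theorem exists_isSimpleModule_smul_ne_self {R M : Type*} [Ring R] [AddCommGroup M] [Module R M]
    [IsSemisimpleModule R M] {r : R} {m : M} (hm : r • m ≠ m) :
    ∃ S : Submodule R M, IsSimpleModule R S ∧ ∃ v : S, r • v ≠ v := by
  by_contra! hfix
  have hmem : m ∈ sSup {S : Submodule R M | IsSimpleModule R S} := by
    rw [IsSemisimpleModule.sSup_simples_eq_top]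
    exact Submodule.mem_top
  rw [sSup_eq_iSup'] at hmem
  refine hm (Submodule.iSup_induction _ (motive := fun v => r • v = v) hmem ?_ (smul_zero r) ?_)
  · exact fun S v hv => congrArg Subtype.val (hfix S S.2 ⟨v, hv⟩)
  · intro v w hv hw
    rw [smul_add, hv, hw]

theorem finite_restrictScalars (k A M : Type*) [CommSemiring k] [Semiring A] [Algebra k A]
    [Module.Finite k A] [AddCommMonoid M] [Module A M] [hM : Module.Finite A M] :
    Module.Finite k (RestrictScalars k A M) := by
  let _ := RestrictScalars.moduleOrig k A M
  have : Module.Finite A (RestrictScalars k A M) := hM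
  exact Module.Finite.trans A _

theorem ofModule_apply_ne_one {k G M : Type*} [CommSemiring k] [Monoid G] [AddCommMonoid M]
    [Module k[G] M] {g : G} {v : M} (hv : MonoidAlgebra.of k G g • v ≠ v) :
    Representation.ofModule (k := k) (G := G) M g ≠ 1 :=
  fun h => hv (LinearMap.congr_fun h ((RestrictScalars.addEquiv k k[G] M).symm v))

universe u v in
theorem exists_isIrreducible_apply_ne_one (k : Type u) [Field k] {G : Type v} [Group G] [Finite G]
    [NeZero (Nat.card G : k)] {g : G} (hg : g ≠ 1) :
    ∃ (V : Type (max u v)) (_ : AddCommGroup V) (_ : Module k V) (_ : FiniteDimensional k V)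
      (ρ : Representation k G V), ρ.IsIrreducible ∧ ρ g ≠ 1 := by
  have hreg : MonoidAlgebra.of k G g • (1 : k[G]) ≠ 1 := by
    rw [smul_eq_mul, mul_one, ← map_one (MonoidAlgebra.of k G)]
    exact MonoidAlgebra.of_injective.ne hg
  obtain ⟨S, hS, v, hv⟩ := exists_isSimpleModule_smul_ne_self hreg
  exact ⟨RestrictScalars k k[G] S, inferInstance, _, finite_restrictScalars k k[G] S,
    Representation.ofModule S, (Representation.isSimpleModule_iff_irreducible_ofModule S).mp hS,
    ofModule_apply_ne_one hv⟩

theorem character_mul_of_apply_eq_smul_one {k G V : Type*} [Monoid G] [Field k] [AddCommGroup V]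
    [Module k V] (ρ : Representation k G V) {z : G} {c : k} (hz : ρ z = c • 1) (g : G) :
    ρ.character (g * z) = c * ρ.character g := by
  simp [Representation.character, hz]

variable {k G V : Type*} [Field k] [IsAlgClosed k] [Group G] [AddCommGroup V] [Module k V]
  [FiniteDimensional k V] (ρ : Representation k G V) [ρ.IsIrreducible]

theorem exists_apply_eq_smul_one_of_mem_center {z : G} (hz : z ∈ center G) :
    ∃ c : k, ρ z = c • 1 := by
  let f : ρ.IntertwiningMap ρ := ⟨ρ z, fun g => by
    change ρ z * ρ g = ρ g * ρ z
    rw [← map_mul, ← map_mul, mem_center_iff.mp hz g]⟩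
  obtain ⟨c, hc⟩ :=
    Representation.IsIrreducible.algebraMap_intertwiningMap_bijective_of_isAlgClosed.surjective f
  exact ⟨c, LinearMap.ext fun v => (DFunLike.congr_fun hc v).symm⟩

theorem character_eq_zero_of_isConj_mul {g z : G} (hz : z ∈ center G) (hρz : ρ z ≠ 1)
    (hg : IsConj g (g * z)) : ρ.character g = 0 := by
  obtain ⟨c, hc⟩ := exists_apply_eq_smul_one_of_mem_center ρ hz
  have hc1 : c ≠ 1 := by
    rintro rfl
    exact hρz (hc.trans (one_smul k 1))
  obtain ⟨y, hy⟩ := isConj_iff.mp hg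
  have hχ : ρ.character g = c * ρ.character g := by
    rw [← character_mul_of_apply_eq_smul_one ρ hc, ← hy, Representation.char_conj]
  by_contra h0
  exact hc1 ((mul_eq_right₀ h0).mp hχ.symm)

theorem character_mul_character_inv_of_mem_center {z : G} (hz : z ∈ center G) :
    ρ.character z * ρ.character z⁻¹ = (Module.finrank k V : k) ^ 2 := by
  obtain ⟨c, hc⟩ := exists_apply_eq_smul_one_of_mem_center ρ hz
  have hz1 : ρ.character z = c * Module.finrank k V := by
    rw [← ρ.char_one, ← character_mul_of_apply_eq_smul_one ρ hc, one_mul]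
  have hinv : (Module.finrank k V : k) = c * ρ.character z⁻¹ := by
    rw [← ρ.char_one, ← character_mul_of_apply_eq_smul_one ρ hc, inv_mul_cancel]
  rw [hz1, mul_right_comm, ← hinv, sq]

theorem index_center_eq_finrank_sq [CharZero k] [Finite G]
    (hχ : ∀ g ∉ center G, ρ.character g = 0) :
    (center G).index = Module.finrank k V ^ 2 := by
  classical
  have := Fintype.ofFinite G
  have hG : (Nat.card G : k) ≠ 0 := Nat.cast_ne_zero.mpr Nat.card_pos.ne'
  have := invertibleOfNonzero hG
  have hnorm : ∑ g : G, ρ.character g * ρ.character g⁻¹ = Nat.card G := by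
    have h := Representation.char_orthonormal ρ ρ
    rwa [if_pos ⟨.refl ρ⟩, inv_mul_eq_one₀ hG, eq_comm] at h
  have hterm (g : G) : ρ.character g * ρ.character g⁻¹ =
      if g ∈ center G then (Module.finrank k V : k) ^ 2 else 0 := by
    split_ifs with hg
    · exact character_mul_character_inv_of_mem_center ρ hg
    · rw [hχ g hg, zero_mul]
  have hcard : (Nat.card G : k) = Nat.card (center G) * (Module.finrank k V : k) ^ 2 := by
    rw [← hnorm, Finset.sum_congr rfl fun g _ => hterm g, ← Finset.sum_filter, Finset.sum_const,
      nsmul_eq_mul, ← Fintype.card_subtype, ← Nat.card_eq_fintype_card]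
  rw [← (center G).card_mul_index] at hcard
  exact Nat.eq_of_mul_eq_mul_left Nat.card_pos (by exact_mod_cast hcard)

end Representation

section Commutator

variable {G : Type*} [Group G]

theorem commutatorElement_mul_mul_of_mem_center {a b : G} (ha : a ∈ center G) (hb : b ∈ center G)
    (x y : G) : ⁅a * x, b * y⁆ = ⁅x, y⁆ := by
  have hleft {c : G} (hc : c ∈ center G) (u v : G) : ⁅c * u, v⁆ = ⁅u, v⁆ := by
    have hcv : Commute c v := (mem_center_iff.mp hc v).symm
    rw [commutatorElement_mul_left_eq_conj_mul, hcv.commutator_eq, mul_one,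
      ← mem_center_iff.mp hc, mul_inv_cancel_right]
  rw [hleft ha, ← commutatorElement_inv, hleft hb, commutatorElement_inv]

/-- The subgroup of elements that commute with `x` modulo the center, defined as the preimage in `G`
of the centralizer of the image of `x` in `G ⧸ center G`. It is the largest subgroup whose
conjugates of `x` all lie in the coset of the center through `x`. -/
def centralizerModCenter (x : G) : Subgroup G :=
  (centralizer {(x : G ⧸ center G)}).comap (QuotientGroup.mk' (center G))

theorem mem_centralizerModCenter {x y : G} :
    y ∈ centralizerModCenter x ↔ ⁅y, x⁆ ∈ center G := by
  rw [centralizerModCenter, mem_comap, mem_centralizer_singleton_iff,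
    ← commutatorElement_eq_one_iff_mul_comm, ← QuotientGroup.eq_one_iff]
  exact Iff.rfl

theorem centralizer_le_centralizerModCenter (x : G) :
    centralizer {x} ≤ centralizerModCenter x := fun y hy => by
  rw [mem_centralizerModCenter,
    commutatorElement_eq_one_iff_mul_comm.mpr (mem_centralizer_singleton_iff.mp hy)]
  exact one_mem _

theorem centralizerModCenter_inf_le (x y : G) :
    centralizerModCenter x ⊓ centralizerModCenter y ≤ centralizer {⁅x, y⁆} := by
  rintro g ⟨hx, hy⟩
  have hconj (w : G) : g * w * g⁻¹ = ⁅g, w⁆ * w := conj_eq_commutatorElement_mul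
  rw [mem_centralizer_singleton_iff, ← mul_inv_eq_iff_eq_mul, conjugate_commutatorElement,
    hconj x, hconj y]
  exact commutatorElement_mul_mul_of_mem_center (mem_centralizerModCenter.mp hx)
    (mem_centralizerModCenter.mp hy) x y

/-- The homomorphism `y ↦ ⁅y, x⁆` into the center, which compares the centralizer of `x` (its
kernel) with the centralizer of `x` modulo the center (its domain). -/
def commutatorHom (x : G) : centralizerModCenter x →* center G where
  toFun y := ⟨⁅(y : G), x⁆, mem_centralizerModCenter.mp y.2⟩
  map_one' := Subtype.ext (commutatorElement_one_left x)
  map_mul' a b := Subtype.ext <| by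
    have hb := mem_center_iff.mp (mem_centralizerModCenter.mp b.2)
    change ⁅(a * b : G), x⁆ = ⁅(a : G), x⁆ * ⁅(b : G), x⁆
    rw [commutatorElement_mul_left_eq_conj_mul, hb, mul_inv_cancel_right, hb]

theorem ker_commutatorHom (x : G) :
    (commutatorHom x).ker = (centralizer {x}).subgroupOf (centralizerModCenter x) := by
  ext y
  rw [MonoidHom.mem_ker, mem_subgroupOf, mem_centralizer_singleton_iff,
    ← commutatorElement_eq_one_iff_mul_comm, Subtype.ext_iff]
  exact Iff.rfl

end Commutator

theorem prime_dvd_relIndex_of_lt {G : Type*} [Group G] {p : ℕ} [Fact p.Prime] (hG : IsPGroup p G)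
    {H K : Subgroup G} [H.FiniteIndex] (hHK : H < K) : p ∣ H.relIndex K := by
  obtain ⟨n, hn⟩ := (hG.to_subgroup K).index (H.subgroupOf K)
  rw [← relIndex] at hn
  rw [hn]
  refine dvd_pow_self p ?_
  rintro rfl
  exact hHK.not_ge (relIndex_eq_one.mp (hn.trans (pow_zero p)))

namespace IsCaminaPair

variable {G : Type*} [Group G]

theorem isSquare_index_center [Finite G] (hG : IsCaminaPair (center G)) :
    IsSquare (center G).index := by
  obtain ⟨z, hz, hz1⟩ := (center G).bot_or_exists_ne_one.resolve_left hG.bot_lt.ne'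
  obtain ⟨V, _, _, _, ρ, _, hρz⟩ := exists_isIrreducible_apply_ne_one ℂ hz1
  rw [index_center_eq_finrank_sq ρ fun g hg =>
    character_eq_zero_of_isConj_mul ρ hz hρz (hG.isConj g hg z hz)]
  exact IsSquare.sq _

theorem mem_center_of_coprime_orderOf [Finite G] (hG : IsCaminaPair (center G)) {p : ℕ}
    [Fact p.Prime] (hp : p ∣ Nat.card (center G)) {g : G} (hg : (orderOf g).Coprime p) :
    g ∈ center G := by
  by_contra hgZ
  obtain ⟨z, hz⟩ := exists_prime_orderOf_dvd_card' p hp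
  rw [← orderOf_coe] at hz
  obtain ⟨y, hy⟩ := isConj_iff.mp (hG.isConj g hgZ z z.2)
  have hcomm : Commute g (z : G) := mem_center_iff.mp z.2 g
  have horder : orderOf g = orderOf g * p := calc
    orderOf g = orderOf (g * z) := by rw [← hy, ← MulAut.conj_apply, MulEquiv.orderOf_eq]
    _ = orderOf g * p := by rw [hcomm.orderOf_mul_eq_mul_orderOf_of_coprime (by rwa [hz]), hz]
  exact (Fact.out : p.Prime).ne_one ((Nat.mul_eq_left (orderOf_pos g).ne').mp horder.symm)

theorem isPGroup_quotient_center [Finite G] (hG : IsCaminaPair (center G)) {p : ℕ}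
    [hp : Fact p.Prime] (hpZ : p ∣ Nat.card (center G)) : IsPGroup p (G ⧸ center G) := by
  rw [isPGroup_iff_pow_pow_eq_one]
  intro q
  obtain ⟨g, rfl⟩ := QuotientGroup.mk_surjective q
  obtain ⟨a, m, hm, hg⟩ :=
    Nat.exists_eq_pow_mul_and_not_dvd (orderOf_pos g).ne' p hp.out.ne_one
  have hdvd : orderOf (g ^ p ^ a) ∣ m := by
    rw [orderOf_dvd_iff_pow_eq_one, ← pow_mul, ← hg, pow_orderOf_eq_one]
  have hcop : (orderOf (g ^ p ^ a)).Coprime p :=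
    ((hp.out.coprime_iff_not_dvd.mpr hm).symm).coprime_dvd_left hdvd
  refine ⟨a, ?_⟩
  rw [← QuotientGroup.mk_pow, QuotientGroup.eq_one_iff]
  exact hG.mem_center_of_coprime_orderOf hpZ hcop

theorem exists_isPGroup [Finite G] (hG : IsCaminaPair (center G)) :
    ∃ p : ℕ, p.Prime ∧ IsPGroup p G := by
  obtain ⟨p, hp, hpdvd⟩ :=
    Nat.exists_prime_and_dvd fun h => hG.bot_lt.ne' ((center G).card_eq_one.mp h)
  have := Fact.mk hp
  have hpQ := hG.isPGroup_quotient_center hpdvd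
  have hdvd : p ∣ Nat.card (G ⧸ center G) :=
    hpQ.card_eq_or_dvd.resolve_left fun h => hG.lt_top.ne (index_eq_one.mp h)
  have hunique {q : ℕ} (hq : q.Prime) (hqZ : q ∣ Nat.card (center G)) : q = p := by
    have := Fact.mk hq
    obtain ⟨m, hm⟩ := IsPGroup.iff_card.mp (hG.isPGroup_quotient_center hqZ)
    exact ((Nat.prime_dvd_prime_iff_eq hp hq).mp (hp.dvd_of_dvd_pow (hm ▸ hdvd))).symm
  have hpZ : IsPGroup p (center G) :=
    .of_card (Nat.eq_prime_pow_of_unique_prime_dvd Nat.card_pos.ne' hunique)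
  obtain ⟨a, ha⟩ := IsPGroup.iff_card.mp hpQ
  obtain ⟨b, hb⟩ := IsPGroup.iff_card.mp hpZ
  refine ⟨p, hp, .of_card (n := a + b) ?_⟩
  rw [card_eq_card_quotient_mul_card_subgroup (center G), ha, hb, pow_add]

theorem commutatorHom_surjective (hG : IsCaminaPair (center G)) {x : G} (hx : x ∉ center G) :
    Function.Surjective (commutatorHom x) := by
  intro z
  obtain ⟨y, hy⟩ := isConj_iff.mp (hG.isConj x hx z z.2)
  have hyz : ⁅y, x⁆ = z := by
    rw [commutatorElement_def, hy, mem_center_iff.mp z.2 x, mul_inv_cancel_right]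
  exact ⟨⟨y, mem_centralizerModCenter.mpr (hyz ▸ z.2)⟩, Subtype.ext hyz⟩

theorem index_centralizer (hG : IsCaminaPair (center G)) {x : G} (hx : x ∉ center G) :
    (centralizer {x}).index = Nat.card (center G) * (centralizerModCenter x).index := by
  rw [← relIndex_mul_index (centralizer_le_centralizerModCenter x), relIndex,
    ← ker_commutatorHom, index_ker,
    MonoidHom.range_eq_top.mpr (hG.commutatorHom_surjective hx), card_top]

theorem mul_card_mul_index_dvd_index_center [Finite G] (hG : IsCaminaPair (center G)) {p : ℕ}
    [Fact p.Prime] (hpG : IsPGroup p G) {x : G} (hx : x ∉ center G) :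
    p * Nat.card (center G) * (centralizerModCenter x).index ∣ (center G).index := by
  have hxC : x ∈ centralizer {x} := mem_centralizer_singleton_iff.mpr rfl
  have hlt : center G < centralizer {x} :=
    lt_of_le_of_ne (center_le_centralizer _) fun h => hx (h ▸ hxC)
  rw [← relIndex_mul_index hlt.le, hG.index_centralizer hx, mul_assoc]
  exact mul_dvd_mul_right (prime_dvd_relIndex_of_lt hpG hlt) _

theorem card_center_le_index_mul_index [Finite G] (hG : IsCaminaPair (center G)) {x y : G}
    (hxy : ⁅x, y⁆ ∉ center G) :
    Nat.card (center G) ≤ (centralizerModCenter x).index * (centralizerModCenter y).index := calc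
  Nat.card (center G) ≤ (centralizer {⁅x, y⁆}).index := by
    rw [hG.index_centralizer hxy]
    exact Nat.le_mul_of_pos_right _ (Nat.pos_of_ne_zero index_ne_zero_of_finite)
  _ ≤ (centralizerModCenter x ⊓ centralizerModCenter y).index :=
    index_antitone (centralizerModCenter_inf_le x y)
  _ ≤ (centralizerModCenter x).index * (centralizerModCenter y).index := index_inf_le

theorem sq_mul_card_center_pow_three_le [Finite G] (hG : IsCaminaPair (center G))
    (hlt : center G < commutator G) {p : ℕ} [Fact p.Prime] (hpG : IsPGroup p G) :
    p ^ 2 * Nat.card (center G) ^ 3 ≤ (center G).index ^ 2 := by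
  obtain ⟨x, y, hxy⟩ : ∃ x y : G, ⁅x, y⁆ ∉ center G := by
    by_contra! h
    exact hlt.not_ge (commutator_le.mpr fun x _ y _ => h x y)
  have hx : x ∉ center G := fun hx => hxy <|
    commutator_le_left _ ⊤ (commutator_mem_commutator hx (mem_top y))
  have hy : y ∉ center G := fun hy => hxy <|
    commutator_le_right ⊤ _ (commutator_mem_commutator (mem_top x) hy)
  have hbound {g : G} (hg : g ∉ center G) :
      p * Nat.card (center G) * (centralizerModCenter g).index ≤ (center G).index :=
    Nat.le_of_dvd (Nat.pos_of_ne_zero index_ne_zero_of_finite)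
      (hG.mul_card_mul_index_dvd_index_center hpG hg)
  calc p ^ 2 * Nat.card (center G) ^ 3
      = (p * Nat.card (center G)) ^ 2 * Nat.card (center G) := by ring
    _ ≤ (p * Nat.card (center G)) ^ 2 *
        ((centralizerModCenter x).index * (centralizerModCenter y).index) := by
      gcongr
      exact hG.card_center_le_index_mul_index hxy
    _ = (p * Nat.card (center G) * (centralizerModCenter x).index) *
        (p * Nat.card (center G) * (centralizerModCenter y).index) := by ring
    _ ≤ (center G).index ^ 2 := by
      rw [sq (center G).index]
      exact Nat.mul_le_mul (hbound hx) (hbound hy)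

theorem exists_card_eq_pow_and_index_eq_pow [Finite G] (hG : IsCaminaPair (center G)) {p : ℕ}
    [hp : Fact p.Prime] (hpG : IsPGroup p G) :
    ∃ k m : ℕ, Nat.card (center G) = p ^ k ∧ (center G).index = p ^ (2 * m) := by
  obtain ⟨k, hk⟩ := IsPGroup.iff_card.mp (hpG.to_subgroup (center G))
  obtain ⟨n, hn⟩ := hpG.index (center G)
  obtain ⟨d, hd⟩ := hG.isSquare_index_center
  obtain ⟨m, -, rfl⟩ := (Nat.dvd_prime_pow hp.out).mp (Dvd.intro d (hd.symm.trans hn))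
  exact ⟨k, m, hk, by rw [hd, two_mul, pow_add]⟩

end IsCaminaPair

theorem theorem4 {G : Type*} [Group G] [Finite G]
    (hG : IsCaminaPair (Subgroup.center G))
    (hlt : Subgroup.center G < commutator G) :
    ∃ p : ℕ, p.Prime ∧ IsPGroup p G ∧
      (Nat.card (Subgroup.center G) ^ 2 ≤ (Subgroup.center G).index ∨
        Nat.card (Subgroup.center G) * p ^ 4 ≤ (Subgroup.center G).index) ∧
      ((Subgroup.center G).index ≤ p ^ 8 →
        (Nat.card (Subgroup.center G) : ℝ) ≤ ((Subgroup.center G).index : ℝ) ^ (1 / 2 : ℝ)) := by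
  obtain ⟨p, hp, hpG⟩ := hG.exists_isPGroup
  have := Fact.mk hp
  obtain ⟨k, m, hk, hm⟩ := hG.exists_card_eq_pow_and_index_eq_pow hpG
  have hkm : 3 * k + 2 ≤ 4 * m := by
    have h := hG.sq_mul_card_center_pow_three_le hlt hpG
    rw [hk, hm, ← pow_mul, ← pow_mul, ← pow_add, Nat.pow_le_pow_iff_right hp.one_lt] at h
    omega
  refine ⟨p, hp, hpG, ?_, fun hle => ?_⟩
  · have hcases : k * 2 ≤ 2 * m ∨ k + 4 ≤ 2 * m := by omega
    rw [hk, hm, ← pow_mul, ← pow_add]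
    exact hcases.imp (Nat.pow_le_pow_right hp.pos) (Nat.pow_le_pow_right hp.pos)
  · rw [hm, Nat.pow_le_pow_iff_right hp.one_lt] at hle
    have hsq : Nat.card (Subgroup.center G) ^ 2 ≤ (Subgroup.center G).index := by
      rw [hk, hm, ← pow_mul]
      exact Nat.pow_le_pow_right hp.pos (by omega)
    rw [← Real.sqrt_eq_rpow]
    exact Real.le_sqrt_of_sq_le (by exact_mod_cast hsq)
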